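/- Let $k\ge 6$ and $d\ge 3$ be integers, and let $G$ be a finite simple $k$-regular graph of girth $2d$ and excess $4$, i.e. whose number of vertices is $n=2\left(1+(k-1)+\dots+(k-1)^{d-1}\right)+4$. Let $A$ be the adjacency matrix of $G$, and let $E$ be its excess matrix: the real $n\times n$ matrix, indexed by the vertices of $G$, with $E_{u,v}=1$ if the distance between $u$ and $v$ in $G$ equals $d+1$, and $E_{u,v}=0$ otherwise. Define polynomials $H_m(x)$ by $H_0(x)=1$, $H_1(x)=x$ and $H_{m+1}(x)=xH_m(x)-(k-1)H_{m-1}(x)$ for $m\ge 1$ (the Dickson polynomials of the second kind with parameter $k-1$). Then: 1. for every eigenvalue $\mu$ of $A$ with $\mu\ne k$ and $\mu\neq -k$ there is an eigenvalue $\lambda$ of $E$ such that $H_{d-1}(\mu)=-\lambda$; 2. $E$ is a polynomial in $A$ with real coefficients; 3. every eigenvector of $A$ is an eigenvector of $E$. -/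

import Mathlib

/-- A `(k, g)`-graph: a `k`-regular graph of girth `g`. -/
structure IsKGGraph {V : Type*} [Fintype V] (G : SimpleGraph V) [DecidableRel G.Adj]
    (k g : ℕ) : Prop where
  regular : G.IsRegularOfDegree k
  egirth_eq : G.egirth = (g : ℕ∞)

/-- The Moore bound `M(k, g)`: it is `1 + k + k(k-1) + ⋯ + k(k-1)^((g-3)/2)` for odd `g`
and `2 (1 + (k-1) + ⋯ + (k-1)^((g-2)/2))` for even `g`. -/
def mooreBound (k g : ℕ) : ℤ :=
  if Odd g then 1 + ∑ i ∈ Finset.range ((g - 1) / 2), (k : ℤ) * ((k : ℤ) - 1) ^ i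
  else 2 * ∑ i ∈ Finset.range (g / 2), ((k : ℤ) - 1) ^ i

/-- A `(k, g)`-graph of excess `e`: the order of the graph exceeds the Moore bound by `e`. -/
structure IsKGGraphOfExcess {V : Type*} [Fintype V] (G : SimpleGraph V) [DecidableRel G.Adj]
    (k g : ℕ) (e : ℤ) : Prop extends IsKGGraph G k g where
  excess_eq : (Fintype.card V : ℤ) - mooreBound k g = e

open Classical in
/-- The `i`-distance matrix of `G`: the entry at `(u, v)` is `1` if `u` and `v` are at
distance exactly `i`, and `0` otherwise. -/
noncomputable def distanceMatrix {V : Type*} (G : SimpleGraph V) (i : ℕ) : Matrix V V ℝ :=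
  Matrix.of fun u v => if G.edist u v = (i : ℕ∞) then 1 else 0

/-- The excess matrix of a graph of girth `2 * d`: the `(d + 1)`-distance matrix. -/
noncomputable def excessMatrix {V : Type*} (G : SimpleGraph V) (d : ℕ) : Matrix V V ℝ :=
  distanceMatrix G (d + 1)

/-- `H_m`, the Dickson polynomial of the second kind of degree `m` with parameter `k - 1`. -/
noncomputable def polyH (k m : ℕ) : Polynomial ℝ :=
  Polynomial.dickson 2 ((k : ℝ) - 1) m

theorem polyH_zero (k : ℕ) : polyH k 0 = 1 := by
  simp only [polyH, Polynomial.dickson_zero]; norm_num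

theorem polyH_one (k : ℕ) : polyH k 1 = Polynomial.X := by
  simp [polyH]

theorem polyH_add_two (k m : ℕ) :
    polyH k (m + 2) =
      Polynomial.X * polyH k (m + 1) - Polynomial.C ((k : ℝ) - 1) * polyH k m := by
  simp [polyH]

/-! For an edge `xy`, a vertex closer than `d` to `x` or `y` is at distance at most `d - 1` and of
the parity of `d - 1` from exactly one of them. Since `H_{d-1}(A)` counts these pairs
(`IsGirthDist.aeval_polyH_apply`), the Moore bound counts these vertices and the excess is the
number of vertices far from `xy`: here 4, less than `k - 1`.

So few far vertices force the diameter to be at most `d + 1` (`IsGirthDist.le_add_one`) and, by a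
count around a vertex equidistant from `x` and `y`, forbid such vertices (`IsGirthDist.ne_of_adj`):
the graph is connected and bipartite.

Hence `E = J - H_{d-1}(A)`, where `J` marks the pairs whose distance has the parity of `d + 1`. `J`
vanishes on eigenspaces of `A` for `μ ≠ ±k` and is scalar on the other two, so `E` is scalar on
every eigenspace of the symmetric matrix `A`, and interpolation makes it a polynomial in `A`. -/

open Finset

/-! ### Short paths and truncated distance -/

namespace SimpleGraph

variable {V : Type*} {G : SimpleGraph V}

/-- Two paths with the same ends whose total length is below the girth coincide. -/
theorem Walk.IsPath.eq_of_length_add_length_lt_egirth {a b : V} {p q : G.Walk a b}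
    (hp : p.IsPath) (hq : q.IsPath) (h : ((p.length + q.length : ℕ) : ℕ∞) < G.egirth) :
    p = q := by
  classical
  -- In the union of the two paths a cycle would have at most `p.length + q.length` edges, fewer
  -- than the girth; so the union is a forest.
  let H : SimpleGraph V := fromEdgeSet {e | e ∈ p.edges ++ q.edges}
  have hHG : ∀ e ∈ H.edgeSet, e ∈ p.edges ++ q.edges := by
    intro e he
    simp only [H, edgeSet_fromEdgeSet] at he
    exact he.1
  have hmem : ∀ e ∈ p.edges ++ q.edges, e ∈ G.edgeSet := by
    intro e he
    rcases List.mem_append.1 he with he | he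
    · exact p.edges_subset_edgeSet he
    · exact q.edges_subset_edgeSet he
  have hGH : ∀ e ∈ p.edges ++ q.edges, e ∈ H.edgeSet := by
    intro e he
    simp only [H, edgeSet_fromEdgeSet]
    exact ⟨he, G.not_isDiag_of_mem_edgeSet (hmem e he)⟩
  have hacyc : H.IsAcyclic := by
    intro c w hw
    have hwG : ∀ e ∈ w.edges, e ∈ G.edgeSet := fun e he =>
      hmem e (hHG e (w.edges_subset_edgeSet he))
    have hc := hw.transfer hwG
    have h1 := G.egirth_le_length hc
    rw [Walk.length_transfer] at h1
    have h2 : w.edges.length ≤ (p.edges ++ q.edges).length :=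
      (List.subperm_of_subset hw.edges_nodup
        fun e he => hHG e (w.edges_subset_edgeSet he)).length_le
    rw [List.length_append, Walk.length_edges, Walk.length_edges, Walk.length_edges] at h2
    exact absurd (h.trans_le h1) (not_lt.2 (by exact_mod_cast h2))
  have hp' : ∀ e ∈ p.edges, e ∈ H.edgeSet := fun e he => hGH e (List.mem_append_left _ he)
  have hq' : ∀ e ∈ q.edges, e ∈ H.edgeSet := fun e he => hGH e (List.mem_append_right _ he)
  have key := (hacyc.subsingleton_path a b).elim ⟨p.transfer H hp', hp.transfer hp'⟩
    ⟨q.transfer H hq', hq.transfer hq'⟩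
  have hs := congrArg (fun r : H.Path a b => (r : H.Walk a b).support) key
  simp only [Walk.support_transfer] at hs
  exact Walk.ext_support hs

/-- The distance in `G`, truncated at `N`. -/
noncomputable def truncDist (G : SimpleGraph V) (N : ℕ) (u v : V) : ℕ :=
  (min (G.edist u v) (N : ℕ∞)).toNat

theorem truncDist_cases (G : SimpleGraph V) (N : ℕ) (u v : V) :
    (G.edist u v = ⊤ ∧ G.truncDist N u v = N) ∨
      ∃ n : ℕ, G.edist u v = n ∧ G.truncDist N u v = min n N := by
  unfold truncDist
  cases h : G.edist u v with
  | top => left; simp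
  | coe n =>
    right
    refine ⟨n, rfl, ?_⟩
    rcases le_total n N with hn | hn
    · rw [min_eq_left (by exact_mod_cast hn), min_eq_left hn, ENat.toNat_natCast]
    · rw [min_eq_right (by exact_mod_cast hn), min_eq_right hn, ENat.toNat_natCast]

theorem edist_eq_iff_truncDist_eq {N i : ℕ} (hi : i < N) {u v : V} :
    G.edist u v = i ↔ G.truncDist N u v = i := by
  rcases G.truncDist_cases N u v with ⟨h, h'⟩ | ⟨n, h, h'⟩ <;> rw [h, h']
  · constructor
    · intro h; simp at h
    · omega
  · rw [Nat.cast_inj]; omega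

theorem truncDist_comm (N : ℕ) (u v : V) : G.truncDist N u v = G.truncDist N v u := by
  rw [truncDist, truncDist, edist_comm]

theorem truncDist_le (N : ℕ) (u v : V) : G.truncDist N u v ≤ N := by
  rcases G.truncDist_cases N u v with ⟨_, h'⟩ | ⟨n, _, h'⟩ <;> omega

theorem truncDist_eq_zero_iff {N : ℕ} (hN : 0 < N) {u v : V} :
    G.truncDist N u v = 0 ↔ u = v := by
  rw [← edist_eq_iff_truncDist_eq hN, Nat.cast_zero, edist_eq_zero_iff]

theorem Adj.truncDist_le_add_one {u w : V} (h : G.Adj u w) (N : ℕ) (v : V) :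
    G.truncDist N u v ≤ G.truncDist N w v + 1 := by
  have ht : G.edist u v ≤ G.edist w v + 1 := by
    have := G.edist_triangle (u := u) (v := w) (w := v)
    rwa [edist_eq_one_iff_adj.2 h, add_comm] at this
  rcases G.truncDist_cases N w v with ⟨h1, h1'⟩ | ⟨n, h1, h1'⟩
  · have := G.truncDist_le N u v; omega
  · rcases G.truncDist_cases N u v with ⟨h2, h2'⟩ | ⟨m, h2, h2'⟩ <;> rw [h1, h2] at ht
    · simp only [top_le_iff] at ht
      exact absurd ht (by exact_mod_cast ENat.natCast_ne_top (n + 1))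
    · have : m ≤ n + 1 := by exact_mod_cast ht
      omega

theorem exists_adj_truncDist_add_one_eq {N : ℕ} {u v : V} (h0 : 0 < G.truncDist N u v)
    (hN : G.truncDist N u v < N) :
    ∃ w, G.Adj u w ∧ G.truncDist N w v + 1 = G.truncDist N u v := by
  obtain ⟨p, hp⟩ := exists_walk_of_edist_eq_coe ((edist_eq_iff_truncDist_eq hN).2 rfl)
  cases p with
  | nil => rw [Walk.length_nil] at hp; omega
  | @cons _ w _ h q =>
    refine ⟨w, h, ?_⟩
    rw [Walk.length_cons] at hp
    have h1 := h.truncDist_le_add_one N v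
    have h2 := G.edist_le q
    rcases G.truncDist_cases N w v with ⟨h3, h3'⟩ | ⟨n, h3, h3'⟩ <;> rw [h3] at h2
    · simp at h2
    · have : n ≤ q.length := by exact_mod_cast h2
      omega

/-- If `q` passed through `u`, its part after `u` would already be as long as `q`, forcing `w = u`.
-/
theorem Adj.cons_isPath_of_length_le_edist {u w v : V} (h : G.Adj u w) {q : G.Walk w v}
    (hq : q.IsPath) (hl : (q.length : ℕ∞) ≤ G.edist u v) : (Walk.cons h q).IsPath := by
  classical
  rw [Walk.cons_isPath_iff]
  refine ⟨hq, fun hu => ?_⟩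
  have h1 : q.length ≤ (q.dropUntil u hu).length := by
    exact_mod_cast hl.trans (G.edist_le (q.dropUntil u hu))
  have h2 := congrArg Walk.length (q.take_spec hu)
  rw [Walk.length_append] at h2
  exact h.ne (Walk.eq_of_length_eq_zero (p := q.takeUntil u hu) (by omega)).symm

theorem exists_path_length_eq_truncDist {N : ℕ} {u v : V} (hN : G.truncDist N u v < N) :
    ∃ p : G.Walk u v, p.IsPath ∧ p.length = G.truncDist N u v := by
  have he := (edist_eq_iff_truncDist_eq (G := G) hN).2 rfl
  obtain ⟨p, hp⟩ := exists_walk_of_edist_eq_coe he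
  refine ⟨p, p.isPath_of_length_eq_dist ?_, hp⟩
  rw [hp, dist, he, ENat.toNat_natCast]

/-- Adjacent vertices at the same distance from a vertex give a short odd cycle. -/
theorem Adj.le_truncDist_of_eq {d N : ℕ} (hg : ((2 * d : ℕ) : ℕ∞) ≤ G.egirth) (hN : d ≤ N)
    {u w v : V} (h : G.Adj u w) (he : G.truncDist N u v = G.truncDist N w v) :
    d ≤ G.truncDist N u v := by
  by_contra! hlt
  obtain ⟨p, hp, hpl⟩ := exists_path_length_eq_truncDist (G := G) (u := u) (v := v)
    (hlt.trans_le hN)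
  obtain ⟨q, hq, hql⟩ := exists_path_length_eq_truncDist (G := G) (u := w) (v := v)
    (N := N) (by omega)
  -- Two paths from `u` to `v` whose lengths differ by one, with total below `2 * d`.
  have hq' : (Walk.cons h q).IsPath := h.cons_isPath_of_length_le_edist hq (by
    rw [(edist_eq_iff_truncDist_eq (G := G) (hlt.trans_le hN)).2 rfl, hql, he])
  have := hp.eq_of_length_add_length_lt_egirth hq' (lt_of_lt_of_le (by
    rw [Walk.length_cons, Nat.cast_lt]; omega) hg)
  have := congrArg Walk.length this
  rw [Walk.length_cons] at this
  omega

/-- Below half the girth, the neighbour one step closer to a vertex is unique. -/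
theorem Adj.eq_of_truncDist_add_one_eq {d N : ℕ} (hg : ((2 * d : ℕ) : ℕ∞) ≤ G.egirth)
    (hN : d ≤ N) {u w w' v : V} (h : G.Adj u w) (h' : G.Adj u w')
    (hw : G.truncDist N w v + 1 = G.truncDist N u v)
    (hw' : G.truncDist N w' v + 1 = G.truncDist N u v) (hlt : G.truncDist N u v < d) :
    w = w' := by
  have he := (edist_eq_iff_truncDist_eq (G := G) (hlt.trans_le hN)).2 rfl
  obtain ⟨p, hp, hpl⟩ := exists_path_length_eq_truncDist (G := G) (u := w) (v := v)
    (N := N) (by omega)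
  obtain ⟨q, hq, hql⟩ := exists_path_length_eq_truncDist (G := G) (u := w') (v := v)
    (N := N) (by omega)
  have hp' : (Walk.cons h p).IsPath := h.cons_isPath_of_length_le_edist hp (by
    rw [he, Nat.cast_le]; omega)
  have hq' : (Walk.cons h' q).IsPath := h'.cons_isPath_of_length_le_edist hq (by
    rw [he, Nat.cast_le]; omega)
  have := hp'.eq_of_length_add_length_lt_egirth hq' (lt_of_lt_of_le (by
    rw [Walk.length_cons, Walk.length_cons, Nat.cast_lt]; omega) hg)
  have := congrArg Walk.snd this
  simpa using this

end SimpleGraph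

namespace SimpleGraph

variable {V : Type*} {G : SimpleGraph V}

/-- The properties of a (possibly truncated) distance function of a graph of girth at least
`2 * d` that the counting arguments use. -/
structure IsGirthDist (G : SimpleGraph V) (d : ℕ) (δ : V → V → ℕ) : Prop where
  comm : ∀ u v, δ u v = δ v u
  eq_zero_iff : ∀ {u v}, δ u v = 0 ↔ u = v
  adj_le : ∀ {u w}, G.Adj u w → ∀ v, δ u v ≤ δ w v + 1
  exists_adj : ∀ {u v}, 0 < δ u v → δ u v ≤ d → ∃ w, G.Adj u w ∧ δ w v + 1 = δ u v
  le_of_eq : ∀ {u w v}, G.Adj u w → δ u v = δ w v → d ≤ δ u v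
  unique : ∀ {u w w' v}, G.Adj u w → G.Adj u w' → δ w v + 1 = δ u v → δ w' v + 1 = δ u v →
    δ u v < d → w = w'

/-- The cutoff must exceed `d`, so that a value equal to `d` is a true distance and a step towards
`v` exists. -/
theorem isGirthDist_truncDist {d N : ℕ} (hg : ((2 * d : ℕ) : ℕ∞) ≤ G.egirth) (hN : d < N) :
    G.IsGirthDist d (G.truncDist N) where
  comm := truncDist_comm N
  eq_zero_iff := truncDist_eq_zero_iff (by omega)
  adj_le h := h.truncDist_le_add_one N
  exists_adj h hd := exists_adj_truncDist_add_one_eq h (hd.trans_lt hN)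
  le_of_eq h := h.le_truncDist_of_eq hg hN.le
  unique h h' := h.eq_of_truncDist_add_one_eq hg hN.le h'

theorem IsGirthDist.eq_one {d : ℕ} {δ : V → V → ℕ} (hδ : G.IsGirthDist d δ) {u w : V}
    (h : G.Adj u w) : δ u w = 1 := by
  have h1 := hδ.adj_le h w
  have h2 : δ w w = 0 := hδ.eq_zero_iff.2 rfl
  have h3 : δ u w ≠ 0 := fun h0 => h.ne (hδ.eq_zero_iff.1 h0)
  omega

end SimpleGraph

/-! ### The polynomials `H_m` at the adjacency matrix -/

/-- For `m = d - 1` this is half the Moore bound, and the row sum of `H_{d-1}(A)`. -/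
theorem polyH_eval_natCast (k m : ℕ) :
    (polyH k m).eval (k : ℝ) = ∑ i ∈ range (m + 1), ((k : ℝ) - 1) ^ i := by
  induction m using Nat.twoStepInduction with
  | zero => simp [polyH_zero]
  | one => simp [polyH_one, sum_range_succ]
  | more m h0 h1 =>
    rw [polyH_add_two, Polynomial.eval_sub, Polynomial.eval_mul, Polynomial.eval_mul,
      Polynomial.eval_X, Polynomial.eval_C, h0, h1, sum_range_succ _ (m + 2),
      sum_range_succ _ (m + 1)]
    ring

theorem Matrix.aeval_mulVec_of_mulVec_eq_smul {n R : Type*} [Fintype n] [DecidableEq n]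
    [CommRing R] {A : Matrix n n R} {μ : R} {v : n → R} (h : A.mulVec v = μ • v)
    (p : Polynomial R) : (Polynomial.aeval A p).mulVec v = p.eval μ • v := by
  induction p using Polynomial.induction_on' with
  | add p q hp hq => rw [map_add, Matrix.add_mulVec, hp, hq, Polynomial.eval_add, add_smul]
  | monomial i a =>
    have hpow : ∀ i : ℕ, (A ^ i).mulVec v = μ ^ i • v := by
      intro i
      induction i with
      | zero => simp
      | succ i ih => rw [pow_succ, ← Matrix.mulVec_mulVec, h, Matrix.mulVec_smul, ih, smul_smul,
          pow_succ']
    rw [Polynomial.aeval_monomial, Polynomial.eval_monomial, ← Algebra.smul_def,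
      Matrix.smul_mulVec, hpow, smul_smul]

namespace SimpleGraph

variable {V : Type*} [Fintype V] [DecidableEq V] {G : SimpleGraph V} [DecidableRel G.Adj]
  {k d : ℕ} {δ : V → V → ℕ}

omit [DecidableEq V] in
theorem IsRegularOfDegree.adjMatrix_mulVec_one (hreg : G.IsRegularOfDegree k) :
    (G.adjMatrix ℝ).mulVec (fun _ => 1) = (k : ℝ) • (fun _ => 1) := by
  ext u
  simp [adjMatrix_mulVec_apply, hreg u]

/-- Below half the girth, `H_m` of the adjacency matrix is the indicator of the pairs whose
distance is at most `m` and has the parity of `m`. -/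
theorem IsGirthDist.aeval_polyH_apply (hδ : G.IsGirthDist d δ) (hreg : G.IsRegularOfDegree k)
    {m : ℕ} (hm : m < d) (u v : V) :
    (Polynomial.aeval (G.adjMatrix ℝ) (polyH k m)) u v =
      if δ u v ≤ m ∧ δ u v % 2 = m % 2 then 1 else 0 := by
  induction m using Nat.twoStepInduction generalizing u v with
  | zero =>
    rw [polyH_zero, map_one, Matrix.one_apply]
    refine if_congr ?_ rfl rfl
    rw [← hδ.eq_zero_iff]
    omega
  | one =>
    rw [polyH_one, Polynomial.aeval_X, adjMatrix_apply]
    refine if_congr ⟨fun h => by rw [hδ.eq_one h]; simp, fun h => ?_⟩ rfl rfl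
    obtain ⟨w, hw, hwv⟩ := hδ.exists_adj (u := u) (v := v) (by omega) (by omega)
    rwa [hδ.eq_zero_iff.1 (show δ w v = 0 by omega)] at hw
  | more m h0 h1 =>
    -- At distance at most `m` (right parity) all `k` neighbours count; at distance `m + 2` only the
    -- unique closer one does.
    have key : ∑ w ∈ G.neighborFinset u,
        (if δ w v ≤ m + 1 ∧ δ w v % 2 = (m + 1) % 2 then (1 : ℝ) else 0) =
        (if δ u v ≤ m + 2 ∧ δ u v % 2 = (m + 2) % 2 then 1 else 0) +
          ((k : ℝ) - 1) * (if δ u v ≤ m ∧ δ u v % 2 = m % 2 then 1 else 0) := by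
      have hadj : ∀ w ∈ G.neighborFinset u, δ u v ≤ δ w v + 1 ∧ δ w v ≤ δ u v + 1 ∧
          (δ u v = δ w v → d ≤ δ u v) := by
        intro w hw
        rw [mem_neighborFinset] at hw
        exact ⟨hδ.adj_le hw v, hδ.adj_le hw.symm v, hδ.le_of_eq hw⟩
      by_cases ha : δ u v ≤ m ∧ δ u v % 2 = m % 2
      · rw [if_pos ha, if_pos (by omega), sum_congr rfl
          fun w hw => if_pos (by have := hadj w hw; omega), sum_const, card_neighborFinset_eq_degree,
          hreg u]
        simp
      · rw [if_neg ha]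
        by_cases hb : δ u v = m + 2
        · obtain ⟨w, hw, hwv⟩ := hδ.exists_adj (u := u) (v := v) (by omega) (by omega)
          rw [if_pos (by omega), sum_eq_single_of_mem w ((mem_neighborFinset _ _ _).2 hw),
            if_pos (by omega)]
          · ring
          · intro w' hw' hne
            rw [if_neg]
            intro hc
            have := hadj w' hw'
            exact hne (hδ.unique ((mem_neighborFinset _ _ _).1 hw') hw (by omega) hwv (by omega))
        · rw [if_neg (by omega), sum_eq_zero fun w hw =>
            if_neg (by have := hadj w hw; omega)]
          ring
    rw [polyH_add_two, map_sub, map_mul, map_mul, Polynomial.aeval_X, Polynomial.aeval_C,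
      ← Algebra.smul_def, Matrix.sub_apply, Matrix.smul_apply, adjMatrix_mul_apply,
      sum_congr rfl fun w _ => h1 (by omega) w v, h0 (by omega), key, smul_eq_mul]
    ring

/-! ### Vertices far from an edge -/

/-- The vertices at distance at least `d` from both `x` and `y`. -/
def farSet (δ : V → V → ℕ) (d : ℕ) (x y : V) : Finset V :=
  univ.filter fun z => d ≤ δ z x ∧ d ≤ δ z y

omit [DecidableEq V] in
theorem mem_farSet {x y z : V} : z ∈ farSet δ d x y ↔ d ≤ δ z x ∧ d ≤ δ z y := by
  simp [farSet]

omit [DecidableEq V] in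
theorem farSet_comm (x y : V) : farSet δ d x y = farSet δ d y x := by
  ext z; simp only [mem_farSet, and_comm]

theorem IsGirthDist.card_farSet (hδ : G.IsGirthDist d δ) (hreg : G.IsRegularOfDegree k)
    (hd : 0 < d) {x y : V} (hxy : G.Adj x y) :
    (Fintype.card V : ℝ) =
      2 * ∑ i ∈ range d, ((k : ℝ) - 1) ^ i + ((farSet δ d x y).card : ℝ) := by
  have hrow : ∀ x, ∑ z, (if δ z x ≤ d - 1 ∧ δ z x % 2 = (d - 1) % 2 then (1 : ℝ) else 0) =
      ∑ i ∈ range d, ((k : ℝ) - 1) ^ i := by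
    intro x
    have h := congrFun (Matrix.aeval_mulVec_of_mulVec_eq_smul hreg.adjMatrix_mulVec_one
      (polyH k (d - 1))) x
    rw [polyH_eval_natCast, Nat.sub_add_cancel hd, Pi.smul_apply, smul_eq_mul, mul_one] at h
    rw [← h, Matrix.mulVec, dotProduct]
    refine sum_congr rfl fun z _ => ?_
    rw [hδ.aeval_polyH_apply hreg (by omega), hδ.comm x z, mul_one]
  have hfar : ((farSet δ d x y).card : ℝ) =
      ∑ z, if d ≤ δ z x ∧ d ≤ δ z y then (1 : ℝ) else 0 := by
    rw [farSet, sum_boole]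
  rw [two_mul]
  nth_rw 1 [← hrow x]
  rw [← hrow y, hfar, ← sum_add_distrib, ← sum_add_distrib, ← card_univ,
    ← nsmul_one (univ : Finset V).card, ← sum_const]
  -- If `z` is not far, its distances to `x` and `y` differ by one, so exactly one has the parity of
  -- `d - 1`, and that one is at most `d - 1`.
  refine sum_congr rfl fun z _ => ?_
  have h1 := hδ.adj_le hxy z
  have h2 := hδ.adj_le hxy.symm z
  have h3 := hδ.le_of_eq hxy (v := z)
  rw [hδ.comm x z, hδ.comm y z] at h1 h2 h3
  split_ifs <;> first | (exfalso; omega) | norm_num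

theorem IsGirthDist.exists_neighbor_notMem_farSet (hreg : G.IsRegularOfDegree k)
    {x y : V} (hX : (farSet δ d x y).card + 1 < k) (u : V) :
    ∃ p, G.Adj u p ∧ p ∉ farSet δ d x y := by
  by_contra! h
  have hsub : G.neighborFinset u ⊆ farSet δ d x y := fun p hp =>
    h p ((mem_neighborFinset _ _ _).1 hp)
  have := card_le_card hsub
  rw [card_neighborFinset_eq_degree, hreg u] at this
  omega

/-- Some neighbour of `u` is not far from an edge `xy`, hence is within `d` of `x`. -/
theorem IsGirthDist.le_add_one (hδ : G.IsGirthDist d δ) (hreg : G.IsRegularOfDegree k)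
    (hk : 0 < k) (hX : ∀ x y, G.Adj x y → (farSet δ d x y).card + 1 < k) (u x : V) : δ u x ≤ d + 1 := by
  by_contra! hlt
  obtain ⟨y, hy⟩ : ∃ y, G.Adj x y := by
    exact (G.degree_pos_iff_exists_adj x).1 (by rwa [hreg x])
  obtain ⟨p, hp, hpX⟩ := exists_neighbor_notMem_farSet hreg (hX x y hy) u
  have h1 := hδ.adj_le hp x
  have h2 := hδ.adj_le hy p
  rw [hδ.comm x p, hδ.comm y p] at h2
  exact hpX (mem_farSet.2 ⟨by omega, by omega⟩)

/-- A neighbour `p` of `u` on the side of `x` has many neighbours far from the edge `xy`. -/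
theorem IsGirthDist.card_le_card_neighbor_farSet (hδ : G.IsGirthDist d δ)
    (hreg : G.IsRegularOfDegree k) (hd : 3 ≤ d) {x y u p : V} (hxy : G.Adj x y)
    (hux : δ u x = d) (huy : δ u y = d) (hup : G.Adj u p) (hpx : δ p x + 1 = d) :
    ((G.neighborFinset u).filter fun q => δ q y + 1 = d).card ≤
      ((G.neighborFinset p).filter fun t => t ∈ farSet δ d x y).card := by
  have hpy : δ p y = d := by
    have h1 := hδ.adj_le hup y
    have h2 := hδ.adj_le hxy p
    have h3 := hδ.adj_le hxy.symm p
    have h4 := hδ.le_of_eq hxy (v := p)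
    rw [hδ.comm x p, hδ.comm y p] at h2 h3 h4
    omega
  -- `f t` is the neighbour of `y` on a shortest path to `t`. It is injective on `U ∪ Q`, so `U` and
  -- `Q` together have at most `k` elements, and `p` has at least `Q.card` neighbours outside `U`.
  have hf : ∀ t, ∃ s, δ t y + 1 = d → G.Adj y s ∧ δ t s + 2 = d := by
    intro t
    by_cases ht : δ t y + 1 = d
    · obtain ⟨s, hs, hst⟩ := hδ.exists_adj (u := y) (v := t) (by rw [hδ.comm]; omega)
        (by rw [hδ.comm]; omega)
      rw [hδ.comm s t, hδ.comm y t] at hst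
      exact ⟨s, fun _ => ⟨hs, by omega⟩⟩
    · exact ⟨t, fun h => absurd h ht⟩
  choose f hf using hf
  have hstep : ∀ a s t : V, δ a y = d → G.Adj a t → G.Adj y s → δ t s + 2 = d →
      δ a s + 1 = d := by
    intro a s t ha hat hys hts
    have h1 := hδ.adj_le hat s
    have h2 := hδ.adj_le hys a
    rw [hδ.comm y a, hδ.comm s a] at h2
    omega
  set Q := (G.neighborFinset u).filter fun q => δ q y + 1 = d with hQ
  set U := (G.neighborFinset p).filter fun q => δ q y + 1 = d with hU
  have hmQ : ∀ t, t ∈ Q ↔ G.Adj u t ∧ δ t y + 1 = d := by simp [hQ]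
  have hmU : ∀ t, t ∈ U ↔ G.Adj p t ∧ δ t y + 1 = d := by simp [hU]
  have hdisj : Disjoint U Q := by
    rw [Finset.disjoint_left]
    intro t htU htQ
    have h1 := hδ.eq_one ((hmU t).1 htU).1
    have h2 := hδ.eq_one ((hmQ t).1 htQ).1
    have := hδ.le_of_eq hup (v := t) (by omega)
    omega
  -- A common value would be at distance `d - 1` from both ends of the edge `up`.
  have hcross : ∀ t t', t ∈ U → t' ∈ Q → f t ≠ f t' := by
    intro t t' ht ht' he
    rw [hmU] at ht
    rw [hmQ] at ht'
    obtain ⟨h1, h2⟩ := hf t ht.2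
    obtain ⟨h1', h2'⟩ := hf t' ht'.2
    rw [← he] at h1' h2'
    have h3 := hstep p _ t hpy ht.1 h1 h2
    have h4 := hstep u _ t' huy ht'.1 h1' h2'
    have := hδ.le_of_eq hup (v := f t) (by omega)
    omega
  have hsame : ∀ a, δ a y = d → ∀ t t', G.Adj a t → G.Adj a t' → δ t y + 1 = d →
      δ t' y + 1 = d → f t = f t' → t = t' := by
    intro a ha t t' hat hat' ht ht' he
    obtain ⟨h1, h2⟩ := hf t ht
    obtain ⟨h1', h2'⟩ := hf t' ht'
    rw [← he] at h1' h2'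
    have h3 := hstep a _ t ha hat h1 h2
    exact hδ.unique (v := f t) hat hat' (by omega) (by omega) (by omega)
  have hcard : (U ∪ Q).card ≤ (G.neighborFinset y).card := by
    refine card_le_card_of_injOn f ?_ ?_
    · intro t ht
      rw [mem_coe, mem_neighborFinset]
      rw [mem_coe, mem_union, hmU, hmQ] at ht
      exact (hf t (by tauto)).1
    · intro t ht t' ht' he
      rw [mem_coe, mem_union] at ht ht'
      rcases ht with ht | ht <;> rcases ht' with ht' | ht'
      · rw [hmU] at ht ht'
        exact hsame p hpy t t' ht.1 ht'.1 ht.2 ht'.2 he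
      · exact absurd he (hcross t t' ht ht')
      · exact absurd he.symm (hcross t' t ht' ht)
      · rw [hmQ] at ht ht'
        exact hsame u huy t t' ht.1 ht'.1 ht.2 ht'.2 he
  rw [card_union_of_disjoint hdisj, card_neighborFinset_eq_degree, hreg y] at hcard
  have hsplit := card_filter_add_card_filter_not (s := G.neighborFinset p)
    (fun q => δ q y + 1 = d)
  rw [card_neighborFinset_eq_degree, hreg p, ← hU] at hsplit
  have hsub : ((G.neighborFinset p).filter fun q => ¬ δ q y + 1 = d) ⊆
      (G.neighborFinset p).filter fun t => t ∈ farSet δ d x y := by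
    intro t ht
    rw [mem_filter, mem_neighborFinset] at ht ⊢
    refine ⟨ht.1, mem_farSet.2 ?_⟩
    have h1 := hδ.adj_le ht.1 x
    have h2 := hδ.adj_le ht.1 y
    have h3 := hδ.adj_le hxy t
    have h4 := hδ.adj_le hxy.symm t
    have h5 := hδ.le_of_eq ht.1 (v := x)
    rw [hδ.comm x t, hδ.comm y t] at h3 h4
    have := ht.2
    omega
  have := card_le_card hsub
  omega

/-- If fewer than `k - 1` vertices are far from the edge `xy`, no vertex is at the same distance
from `x` and `y`. -/
theorem IsGirthDist.ne_of_adj (hδ : G.IsGirthDist d δ) (hreg : G.IsRegularOfDegree k)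
    (hd : 3 ≤ d) {x y : V} (hxy : G.Adj x y) (hX : (farSet δ d x y).card + 1 < k) (u : V) :
    δ u x ≠ δ u y := by
  intro he
  have hge : d ≤ δ u x := by
    have := hδ.le_of_eq hxy (v := u) (by rw [hδ.comm x, hδ.comm y, he])
    rwa [hδ.comm] at this
  obtain ⟨p₀, hp₀, hp₀X⟩ := exists_neighbor_notMem_farSet hreg hX u
  have hux : δ u x = d := by
    by_contra hne
    have h1 := hδ.adj_le hp₀ x
    have h2 := hδ.adj_le hp₀ y
    exact hp₀X (mem_farSet.2 ⟨by omega, by omega⟩)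
  have huy : δ u y = d := he ▸ hux
  set X := farSet δ d x y
  have huX : u ∈ X := mem_farSet.2 ⟨by omega, by omega⟩
  set N := G.neighborFinset u with hN
  have hmN : ∀ p, p ∈ N ↔ G.Adj u p := by simp [hN]
  have hNcard : N.card = k := by rw [hN, card_neighborFinset_eq_degree, hreg u]
  set P := N.filter fun p => δ p x + 1 = d with hP
  set Q := N.filter fun p => δ p y + 1 = d with hQ
  set R := N.filter fun p => ¬ (δ p x + 1 = d ∨ δ p y + 1 = d) with hR
  have hPQ : Disjoint P Q := by
    rw [Finset.disjoint_left]
    intro p hp hq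
    have h1 := (mem_filter.1 hp).2
    have h2 := (mem_filter.1 hq).2
    have := hδ.le_of_eq hxy (v := p) (by rw [hδ.comm x, hδ.comm y]; omega)
    rw [hδ.comm] at this
    omega
  have hunion : N.filter (fun p => δ p x + 1 = d ∨ δ p y + 1 = d) = P ∪ Q := filter_or _ _ _
  have hpart : ∀ g : V → ℕ, ∑ p ∈ N, g p = ∑ p ∈ P, g p + ∑ p ∈ Q, g p + ∑ p ∈ R, g p := by
    intro g
    rw [← sum_union hPQ, ← hunion, hR, sum_filter_add_sum_filter_not]
  let T : V → Finset V := fun p => ((G.neighborFinset p).filter fun t => t ∈ X).erase u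
  -- Each neighbour `p` of `u` contributes far vertices other than `u`: itself if far, otherwise its
  -- far neighbours. As `2 < d`, these sets are disjoint.
  let S : V → Finset V := fun p => if p ∈ X then {p} else T p
  have hmT : ∀ p t, t ∈ T p ↔ t ≠ u ∧ G.Adj p t ∧ t ∈ X := by simp [T]
  have hSX : ∀ p ∈ N, S p ⊆ X.erase u := by
    intro p hp t ht
    simp only [S] at ht
    split_ifs at ht with hpX
    · rw [mem_singleton] at ht
      rw [ht, mem_erase]
      exact ⟨((hmN p).1 hp).ne', hpX⟩
    · rw [hmT] at ht
      exact mem_erase.2 ⟨ht.1, ht.2.2⟩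
  have hdist2 : ∀ p ∈ N, ∀ t ∈ T p, δ t u = 2 := by
    intro p hp t ht
    rw [hmT] at ht
    rw [hmN] at hp
    have h1 := hδ.eq_one hp.symm
    have h2 := hδ.adj_le ht.2.1.symm u
    have h3 : δ t u ≠ 0 := fun h => ht.1 (hδ.eq_zero_iff.1 h)
    have h4 := hδ.le_of_eq ht.2.1 (v := u)
    omega
  have hdisj : (N : Set V).PairwiseDisjoint S := by
    intro p hp p' hp' hne
    rw [mem_coe] at hp hp'
    rw [Function.onFun, Finset.disjoint_left]
    intro t ht ht'
    have h1 := hδ.eq_one ((hmN p).1 hp).symm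
    have h1' := hδ.eq_one ((hmN p').1 hp').symm
    simp only [S] at ht ht'
    split_ifs at ht ht' with hpX hpX' hpX'
    · exact hne ((mem_singleton.1 ht).symm.trans (mem_singleton.1 ht'))
    · have := hdist2 p' hp' t ht'
      rw [mem_singleton.1 ht] at this
      omega
    · have := hdist2 p hp t ht
      rw [mem_singleton.1 ht'] at this
      omega
    · have h2 := hdist2 p hp t ht
      rw [hmT] at ht ht'
      exact hne (hδ.unique ht.2.1.symm ht'.2.1.symm (v := u) (by omega) (by omega) (by omega))
  have hsum : ∑ p ∈ N, (S p).card + 1 ≤ X.card := by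
    rw [← card_biUnion hdisj, ← card_erase_add_one huX]
    exact Nat.add_le_add_right (card_le_card (biUnion_subset.2 hSX)) 1
  have hnotX : ∀ p, δ p x + 1 = d ∨ δ p y + 1 = d → p ∉ X := by
    intro p hp hpX
    have := mem_farSet.1 hpX
    omega
  have hSP : ∀ p ∈ P, Q.card - 1 ≤ (S p).card := by
    intro p hp
    have hp := mem_filter.1 hp
    have h1 := hδ.card_le_card_neighbor_farSet hreg hd hxy hux huy ((hmN p).1 hp.1) hp.2
    simp only [S, if_neg (hnotX p (Or.inl hp.2)), T]
    exact (Nat.sub_le_sub_right h1 1).trans pred_card_le_card_erase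
  have hSQ : ∀ p ∈ Q, P.card - 1 ≤ (S p).card := by
    intro p hp
    have hp := mem_filter.1 hp
    have h1 := hδ.card_le_card_neighbor_farSet hreg hd hxy.symm huy hux ((hmN p).1 hp.1) hp.2
    rw [farSet_comm] at h1
    simp only [S, if_neg (hnotX p (Or.inr hp.2)), T]
    exact (Nat.sub_le_sub_right h1 1).trans pred_card_le_card_erase
  have hSR : ∀ p ∈ R, 1 ≤ (S p).card := by
    intro p hp
    have hp := mem_filter.1 hp
    have h1 := hδ.adj_le ((hmN p).1 hp.1) x
    have h2 := hδ.adj_le ((hmN p).1 hp.1) y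
    have hpX : p ∈ X := mem_farSet.2 ⟨by omega, by omega⟩
    simp [S, hpX]
  have hclose : ∀ z, δ u z = d → 1 ≤ (N.filter fun p => δ p z + 1 = d).card := by
    intro z hz
    obtain ⟨p, hp, hpz⟩ := hδ.exists_adj (u := u) (v := z) (by omega) hz.le
    exact card_pos.2 ⟨p, mem_filter.2 ⟨(hmN p).2 hp, by omega⟩⟩
  have ha : 1 ≤ P.card := hclose x hux
  have hb : 1 ≤ Q.card := hclose y huy
  have hP' := card_nsmul_le_sum P _ _ hSP
  have hQ' := card_nsmul_le_sum Q _ _ hSQ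
  have hR' := card_nsmul_le_sum R _ _ hSR
  have hk' := hpart fun _ => 1
  simp only [sum_const, smul_eq_mul, mul_one, hNcard] at hk' hP' hQ' hR'
  rw [hpart] at hsum
  -- With `P.card = 1 + a` and `Q.card = 1 + b`, the bounds give `X.card ≥ k - 1 + 2ab`, against
  -- `hX`.
  obtain ⟨a, ha⟩ := Nat.exists_eq_add_of_le ha
  obtain ⟨b, hb⟩ := Nat.exists_eq_add_of_le hb
  rw [ha, hb] at hP' hQ' hk'
  simp only [Nat.add_sub_cancel_left] at hP' hQ'
  nlinarith [Nat.zero_le (a * b)]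

end SimpleGraph

/-! ### Polynomials in a symmetric matrix -/

/-- A matrix acting as a scalar on every eigenspace of a Hermitian matrix `A` is a polynomial
in `A`. -/
theorem Matrix.IsHermitian.exists_eq_aeval {n : Type*} [Fintype n] [DecidableEq n]
    {A B : Matrix n n ℝ} (hA : A.IsHermitian)
    (h : ∀ μ : ℝ, ∃ l : ℝ, ∀ v, A.mulVec v = μ • v → B.mulVec v = l • v) :
    ∃ p : Polynomial ℝ, B = Polynomial.aeval A p := by
  choose l hl using h
  -- The polynomial sends each eigenvalue to its scalar, so both matrices agree on an eigenbasis.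
  let p := Lagrange.interpolate (univ.image hA.eigenvalues) id l
  refine ⟨p, ?_⟩
  have hlin : Matrix.toEuclideanLin B = Matrix.toEuclideanLin (Polynomial.aeval A p) := by
    refine hA.eigenvectorBasis.toBasis.ext fun j => ?_
    have hj := hA.mulVec_eigenvectorBasis j
    have hp : p.eval (hA.eigenvalues j) = l (hA.eigenvalues j) :=
      Lagrange.eval_interpolate_at_node (v := id) l Function.injective_id.injOn
        (mem_image_of_mem _ (mem_univ j))
    rw [OrthonormalBasis.coe_toBasis, Matrix.toLpLin_apply, Matrix.toLpLin_apply, hl _ _ hj,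
      Matrix.aeval_mulVec_of_mulVec_eq_smul hj, hp]
  exact Matrix.toEuclideanLin.injective hlin

/-! ### The parity matrix of a bipartite graph -/

namespace SimpleGraph

variable {V : Type*} [Fintype V] {G : SimpleGraph V} [DecidableRel G.Adj]
  {k d : ℕ} {δ : V → V → ℕ}

/-- The indicator matrix of the pairs `(u, v)` such that `δ u v` has the parity of `c`. -/
def parityMatrix (δ : V → V → ℕ) (c : ℕ) : Matrix V V ℝ :=
  Matrix.of fun u v => if δ u v % 2 = c % 2 then 1 else 0

omit [Fintype V] in
theorem parityMatrix_apply (c : ℕ) (u v : V) :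
    parityMatrix δ c u v = if δ u v % 2 = c % 2 then 1 else 0 := rfl

theorem parityMatrix_mul_adjMatrix (hreg : G.IsRegularOfDegree k)
    (hpar : ∀ u x y, G.Adj x y → δ u x % 2 ≠ δ u y % 2) (c : ℕ) :
    parityMatrix δ c * G.adjMatrix ℝ = (k : ℝ) • parityMatrix δ (c + 1) := by
  ext u v
  rw [mul_adjMatrix_apply, Matrix.smul_apply, parityMatrix_apply]
  have : ∀ w ∈ G.neighborFinset v, parityMatrix δ c u w =
      if δ u v % 2 = (c + 1) % 2 then 1 else 0 := by
    intro w hw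
    have := hpar u v w ((mem_neighborFinset _ _ _).1 hw)
    rw [parityMatrix_apply]
    exact if_congr (by omega) rfl rfl
  rw [sum_congr rfl this, sum_const, card_neighborFinset_eq_degree, hreg v, nsmul_eq_mul,
    smul_eq_mul]

theorem smul_parityMatrix_mulVec (hreg : G.IsRegularOfDegree k)
    (hpar : ∀ u x y, G.Adj x y → δ u x % 2 ≠ δ u y % 2) {μ : ℝ} {v : V → ℝ}
    (hv : (G.adjMatrix ℝ).mulVec v = μ • v) (c : ℕ) :
    μ • (parityMatrix δ c).mulVec v = (k : ℝ) • (parityMatrix δ (c + 1)).mulVec v := by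
  rw [← Matrix.mulVec_smul, ← hv, Matrix.mulVec_mulVec, parityMatrix_mul_adjMatrix hreg hpar,
    Matrix.smul_mulVec]

omit [Fintype V] in
theorem parityMatrix_add_two (c : ℕ) : parityMatrix δ (c + 1 + 1) = parityMatrix δ c := by
  ext u v
  rw [parityMatrix_apply, parityMatrix_apply]
  exact if_congr (by omega) rfl rfl

/-- Applied to the all-ones vector, the previous relation makes the two parity classes equal in
size. -/
theorem sum_parityMatrix (hreg : G.IsRegularOfDegree k) (hk : 0 < k)
    (hpar : ∀ u x y, G.Adj x y → δ u x % 2 ≠ δ u y % 2) (c : ℕ) (u : V) :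
    ∑ w, parityMatrix δ c u w = (Fintype.card V : ℝ) / 2 := by
  classical
  have h := congrFun (smul_parityMatrix_mulVec hreg hpar hreg.adjMatrix_mulVec_one c) u
  simp only [Pi.smul_apply, smul_eq_mul, Matrix.mulVec, dotProduct, mul_one] at h
  have h1 := mul_left_cancel₀ (by exact_mod_cast hk.ne') h
  have h2 : ∑ w, parityMatrix δ c u w + ∑ w, parityMatrix δ (c + 1) u w = Fintype.card V := by
    rw [← sum_add_distrib, ← card_univ, ← nsmul_one (univ : Finset V).card, ← sum_const]
    refine sum_congr rfl fun w _ => ?_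
    rw [parityMatrix_apply, parityMatrix_apply]
    split_ifs <;> first | (exfalso; omega) | norm_num
  linarith

/-- In a connected regular bipartite graph, an eigenvector for `ε * k`, `ε = ± 1`, is determined
by its value at a single vertex. -/
theorem eq_pow_mul_of_mulVec_eq_smul (hreg : G.IsRegularOfDegree k)
    (hconn : ∀ u w, G.Reachable u w) (hpar : ∀ u x y, G.Adj x y → δ u x % 2 ≠ δ u y % 2)
    (h0 : ∀ u, δ u u = 0) {ε : ℝ} (hε : ε ^ 2 = 1) {v : V → ℝ}
    (hv : (G.adjMatrix ℝ).mulVec v = (ε * k) • v) (u w : V) : v w = ε ^ δ u w * v u := by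
  classical
  have hmod : ∀ n m : ℕ, n % 2 = m % 2 → ε ^ n = ε ^ m := by
    intro n m h
    rw [← Nat.div_add_mod n 2, ← Nat.div_add_mod m 2, h, pow_add, pow_add, pow_mul, pow_mul, hε,
      one_pow, one_pow]
  -- Twisting by the sign `ε ^ δ u w` puts the eigenvector in the Laplacian kernel, so the twist is
  -- constant by connectivity.
  have hker : (G.lapMatrix ℝ).mulVec (fun w => ε ^ δ u w * v w) = 0 := by
    ext w
    have hw := congrFun hv w
    rw [adjMatrix_mulVec_apply, Pi.smul_apply, smul_eq_mul] at hw
    rw [lapMatrix_mulVec_apply, hreg w, sum_congr rfl fun t ht => by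
      rw [hmod (δ u t) (δ u w + 1) (by
        have := hpar u w t ((mem_neighborFinset _ _ _).1 ht); omega)], ← mul_sum, hw,
      Pi.zero_apply, pow_succ]
    linear_combination (-(k : ℝ) * ε ^ δ u w * v w) * hε
  have h := (G.lapMatrix_mulVec_eq_zero_iff_forall_reachable).1 hker u w (hconn u w)
  simp only [h0, pow_zero, one_mul] at h
  rw [h, ← mul_assoc, ← pow_add, ← two_mul, pow_mul, hε, one_pow, one_mul]

/-- The parity matrix acts as a scalar on each eigenspace of the adjacency matrix. -/
theorem exists_parityMatrix_mulVec_eq_smul (hreg : G.IsRegularOfDegree k) (hk : 0 < k)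
    (hconn : ∀ u w, G.Reachable u w) (hpar : ∀ u x y, G.Adj x y → δ u x % 2 ≠ δ u y % 2)
    (h0 : ∀ u, δ u u = 0) (c : ℕ) (μ : ℝ) :
    ∃ l : ℝ, (μ ≠ k → μ ≠ -k → l = 0) ∧
      ∀ v, (G.adjMatrix ℝ).mulVec v = μ • v → (parityMatrix δ c).mulVec v = l • v := by
  have hsign : ∀ ε : ℝ, ε ^ 2 = 1 → ∀ v, (G.adjMatrix ℝ).mulVec v = (ε * k) • v →
      (parityMatrix δ c).mulVec v = (ε ^ c * (Fintype.card V / 2)) • v := by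
    intro ε hε v hv
    ext u
    rw [Pi.smul_apply, smul_eq_mul, ← sum_parityMatrix hreg hk hpar c u, Matrix.mulVec,
      dotProduct, mul_right_comm, mul_sum]
    refine sum_congr rfl fun w _ => ?_
    rw [parityMatrix_apply]
    split_ifs with h
    · rw [eq_pow_mul_of_mulVec_eq_smul hreg hconn hpar h0 hε hv u w, one_mul, mul_one,
        ← Nat.div_add_mod (δ u w) 2, ← Nat.div_add_mod c 2, h, pow_add, pow_add, pow_mul, pow_mul,
        hε, one_pow, one_pow]
    · rw [zero_mul, mul_zero]
  by_cases h1 : μ = k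
  · exact ⟨_, fun h => absurd h1 h, fun v hv => hsign 1 (one_pow 2) v (by rw [one_mul, ← h1, hv])⟩
  by_cases h2 : μ = -k
  · exact ⟨_, fun _ h => absurd h2 h, fun v hv =>
      hsign (-1) (by norm_num) v (by rw [neg_one_mul, ← h2, hv])⟩
  refine ⟨0, fun _ _ => rfl, fun v hv => ?_⟩
  have ha := smul_parityMatrix_mulVec hreg hpar hv c
  have hb := smul_parityMatrix_mulVec hreg hpar hv (c + 1)
  rw [parityMatrix_add_two] at hb
  -- Two steps return to the same parity and multiply by `k ^ 2` in place of `μ ^ 2`.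
  have hc : (μ ^ 2 - (k : ℝ) ^ 2) • (parityMatrix δ c).mulVec v = 0 := by
    rw [sub_smul, pow_two, pow_two, mul_smul, mul_smul, ha, ← hb, smul_comm, sub_self]
  rw [zero_smul]
  refine (smul_eq_zero.1 hc).resolve_left fun h => ?_
  rw [sq_sub_sq] at h
  rcases mul_eq_zero.1 h with h | h
  · exact h2 (by linarith)
  · exact h1 (by linarith)

end SimpleGraph

/-! ### The excess matrix and the main theorem -/

namespace SimpleGraph

variable {V : Type*} [Fintype V] [DecidableEq V] {G : SimpleGraph V} [DecidableRel G.Adj] {k d : ℕ}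

/-- Under the diameter bound, a distance with the parity of `d + 1` is either `d + 1` or at most `d
- 1`. Cutting off at `d + 2` keeps `d + 1` distinct from infinite distance. -/
theorem excessMatrix_eq_parityMatrix_sub (hd : 0 < d)
    (hg : ((2 * d : ℕ) : ℕ∞) ≤ G.egirth) (hreg : G.IsRegularOfDegree k)
    (hdiam : ∀ u v, G.truncDist (d + 2) u v ≤ d + 1) :
    excessMatrix G d = parityMatrix (G.truncDist (d + 2)) (d + 1) -
      Polynomial.aeval (G.adjMatrix ℝ) (polyH k (d - 1)) := by
  ext u v
  have hδ := isGirthDist_truncDist hg (show d < d + 2 by omega)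
  rw [Matrix.sub_apply, hδ.aeval_polyH_apply hreg (by omega), parityMatrix_apply, excessMatrix,
    distanceMatrix, Matrix.of_apply]
  simp only [edist_eq_iff_truncDist_eq (show d + 1 < d + 2 by omega)]
  have := hdiam u v
  split_ifs <;> first | (exfalso; omega) | norm_num

end SimpleGraph

theorem IsKGGraphOfExcess.card_farSet {V : Type*} [Fintype V] [DecidableEq V] {G : SimpleGraph V}
    [DecidableRel G.Adj] {k d e : ℕ} (hG : IsKGGraphOfExcess G k (2 * d) e) (hd : 0 < d)
    {δ : V → V → ℕ} (hδ : G.IsGirthDist d δ) {x y : V} (hxy : G.Adj x y) :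
    (SimpleGraph.farSet δ d x y).card = e := by
  have h1 := hδ.card_farSet hG.regular hd hxy
  have h2 := congrArg (Int.cast : ℤ → ℝ) hG.excess_eq
  rw [mooreBound, if_neg (by rw [Nat.not_odd_iff_even]; exact even_two_mul d),
    Nat.mul_div_cancel_left d two_pos] at h2
  push_cast at h2
  have : ((SimpleGraph.farSet δ d x y).card : ℝ) = e := by linarith
  exact_mod_cast this

theorem mainTheorem2 {V : Type*} [Fintype V] [DecidableEq V] (G : SimpleGraph V)
    [DecidableRel G.Adj] (k d : ℕ) (hk : 6 ≤ k) (hd : 3 ≤ d)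
    (hG : IsKGGraphOfExcess G k (2 * d) 4) :
    (∀ μ : ℝ, Module.End.HasEigenvalue (Matrix.toLin' (G.adjMatrix ℝ)) μ →
      μ ≠ (k : ℝ) → μ ≠ -(k : ℝ) →
      ∃ l : ℝ, Module.End.HasEigenvalue (Matrix.toLin' (excessMatrix G d)) l ∧
        (polyH k (d - 1)).eval μ = -l) ∧
    (∃ p : Polynomial ℝ, excessMatrix G d = Polynomial.aeval (G.adjMatrix ℝ) p) ∧
    (∀ (μ : ℝ) (v : V → ℝ),
      Module.End.HasEigenvector (Matrix.toLin' (G.adjMatrix ℝ)) μ v →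
      ∃ l : ℝ, Module.End.HasEigenvector (Matrix.toLin' (excessMatrix G d)) l v) := by
  have hreg := hG.regular
  have hg : ((2 * d : ℕ) : ℕ∞) ≤ G.egirth := hG.egirth_eq.ge
  have hδ := SimpleGraph.isGirthDist_truncDist hg (show d < d + 2 by omega)
  set δ := G.truncDist (d + 2)
  have hX : ∀ x y, G.Adj x y → (SimpleGraph.farSet δ d x y).card + 1 < k := by
    intro x y hxy
    rw [IsKGGraphOfExcess.card_farSet (e := 4) (by exact_mod_cast hG) (by omega) hδ hxy]
    omega
  have hdiam : ∀ u v, δ u v ≤ d + 1 := hδ.le_add_one hreg (by omega) hX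
  -- Connectedness is not assumed: unreachable pairs would have truncated distance `d + 2`.
  have hconn : ∀ u w, G.Reachable u w := by
    intro u w
    refine SimpleGraph.reachable_of_edist_ne_top ?_
    rw [(SimpleGraph.edist_eq_iff_truncDist_eq
      (show δ u w < d + 2 from Nat.lt_succ_of_le (hdiam u w))).2 rfl]
    exact ENat.natCast_ne_top _
  have hpar : ∀ u x y, G.Adj x y → δ u x % 2 ≠ δ u y % 2 := by
    intro u x y hxy
    have h1 := hδ.ne_of_adj hreg hd hxy (hX x y hxy) u
    have h2 := hδ.adj_le hxy u
    have h3 := hδ.adj_le hxy.symm u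
    rw [hδ.comm x u, hδ.comm y u] at h2 h3
    omega
  have hE := SimpleGraph.excessMatrix_eq_parityMatrix_sub (by omega) hg hreg hdiam
  have hscalar : ∀ μ : ℝ, ∃ l : ℝ,
      (μ ≠ k → μ ≠ -k → (polyH k (d - 1)).eval μ = -l) ∧
        ∀ v, (G.adjMatrix ℝ).mulVec v = μ • v → (excessMatrix G d).mulVec v = l • v := by
    intro μ
    obtain ⟨l, hl0, hl⟩ := SimpleGraph.exists_parityMatrix_mulVec_eq_smul hreg (by omega) hconn
      hpar (fun u => hδ.eq_zero_iff.2 rfl) (d + 1) μ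
    refine ⟨l - (polyH k (d - 1)).eval μ, fun h h' => by rw [hl0 h h']; ring, fun v hv => ?_⟩
    rw [hE, Matrix.sub_mulVec, hl v hv, Matrix.aeval_mulVec_of_mulVec_eq_smul hv, sub_smul]
  have hvec : ∀ μ v, Module.End.HasEigenvector (Matrix.toLin' (G.adjMatrix ℝ)) μ v →
      ∃ l : ℝ, (μ ≠ k → μ ≠ -k → (polyH k (d - 1)).eval μ = -l) ∧
        Module.End.HasEigenvector (Matrix.toLin' (excessMatrix G d)) l v := by
    intro μ v hv
    obtain ⟨l, hl0, hl⟩ := hscalar μ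
    refine ⟨l, hl0, Module.End.mem_eigenspace_iff.2 ?_, hv.2⟩
    have := hv.apply_eq_smul
    rw [Matrix.toLin'_apply] at this ⊢
    exact hl v this
  refine ⟨fun μ hμ hk1 hk2 => ?_, ?_, fun μ v hv => ?_⟩
  · obtain ⟨v, hv⟩ := hμ.exists_hasEigenvector
    obtain ⟨l, hl0, hl⟩ := hvec μ v hv
    exact ⟨l, Module.End.hasEigenvalue_of_hasEigenvector hl, hl0 hk1 hk2⟩
  · refine (G.isHermitian_adjMatrix ℝ).exists_eq_aeval fun μ => ?_
    obtain ⟨l, -, hl⟩ := hscalar μ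
    exact ⟨l, hl⟩
  · obtain ⟨l, -, hl⟩ := hvec μ v hv
    exact ⟨l, hl⟩
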